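/- Let $(\Omega,\mathcal F,\mathbb P)$ be a probability space carrying a standard Brownian sheet $\mathbf W=\{\mathbf W(t_1,t_2):(t_1,t_2)\in[0,1]^2\}$, i.e. a centered Gaussian process with $\mathbb E[\mathbf W(s_1,s_2)\mathbf W(t_1,t_2)]=(s_1\wedge t_1)(s_2\wedge t_2)$. For $f\in L^2([0,1]^2)$ let $\int_{[0,1]^2} f(x)\,\mathbf W(dx)$ denote the Wiener integral of $f$: the $L^2(\mathbb P)$-limit of the sums $\sum_i c_i\mathbf W(t^{(i)})$ along finite linear combinations $\sum_i c_i\mathbf 1_{[0,t^{(i)}_1]\times[0,t^{(i)}_2]}$ converging to $f$ in $L^2([0,1]^2)$. Let $\phi\in L^2([0,1]^4)$ be real-valued, regarded as a function on $[0,1]^2\times[0,1]^2$. Then there exist random functions $X,Y:[0,1]^2\times\Omega\to\mathbb R$, jointly measurable in $(t,\omega)$, such that for almost every $t\in[0,1]^2$ $$X(t)=\int_{[0,1]^2}\phi(t,x)\,\mathbf W(dx)\quad\text{a.s.},\qquad Y(t)=\int_{[0,1]^2}\phi(x,t)\,\mathbf W(dx)\quad\text{a.s.}$$ Moreover, for all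 such measurable $X$ and $Y$, the functions $t\mapsto X(t)^2$ and $t\mapsto Y(t)^2$ are almost surely Lebesgue integrable on $[0,1]^2$, and $$\int_{[0,1]^2}\Big[\int_{[0,1]^2}\phi(t,x)\,\mathbf W(dx)\Big]^2dt\;\overset{\text{law}}{=}\;\int_{[0,1]^2}\Big[\int_{[0,1]^2}\phi(x,t)\,\mathbf W(dx)\Big]^2dt ,$$ that is, $\int_{[0,1]^2}X(t)^2\,dt$ and $\int_{[0,1]^2}Y(t)^2\,dt$ have the same law. -/

import Mathlib

open MeasureTheory ProbabilityTheory Filter Topology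

noncomputable section

/-- The unit square `[0,1]²`; its `volume` is two-dimensional Lebesgue measure, and its order is
the coordinatewise one, so that `Set.Iic (t₁, t₂)` is the rectangle `[0,t₁] × [0,t₂]`. -/
abbrev UnitSquare : Type := unitInterval × unitInterval

/-- `W` is a standard Brownian sheet on `[0,1]²`: a centered Gaussian process with covariance
`E[W(s₁,s₂) W(t₁,t₂)] = (s₁ ∧ t₁)(s₂ ∧ t₂)`. -/
structure IsBrownianSheet {Ω : Type*} [MeasurableSpace Ω] (W : UnitSquare → Ω → ℝ)
    (P : Measure Ω) : Prop where
  isGaussianProcess : IsGaussianProcess W P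
  centered : ∀ t, ∫ ω, W t ω ∂P = 0
  covariance : ∀ s t, ∫ ω, W s ω * W t ω ∂P
    = min (s.1 : ℝ) (t.1 : ℝ) * min (s.2 : ℝ) (t.2 : ℝ)

/-- The step function `∑ₜ c(t) 1_{[0,t₁] × [0,t₂]}` given by finitely many coefficients. -/
def stepFunction (c : UnitSquare →₀ ℝ) (x : UnitSquare) : ℝ :=
  c.sum fun t a => a * (Set.Iic t).indicator (fun _ => (1 : ℝ)) x

/-- The elementary integral `∑ₜ c(t) W(t)` of the step function `∑ₜ c(t) 1_{[0,t₁] × [0,t₂]}`. -/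
def stepIntegral {Ω : Type*} (W : UnitSquare → Ω → ℝ) (c : UnitSquare →₀ ℝ) (ω : Ω) : ℝ :=
  c.sum fun t a => a * W t ω

/-- `X` is (a version of) the Wiener integral `∫ f(x) W(dx)` of `f ∈ L²([0,1]²)`: it is the limit
in `L²(P)` of the elementary integrals of some step functions that converge to `f` in
`L²([0,1]²)`. -/
def IsWienerIntegral {Ω : Type*} [MeasurableSpace Ω] (W : UnitSquare → Ω → ℝ) (P : Measure Ω)
    (f : UnitSquare → ℝ) (X : Ω → ℝ) : Prop :=
  MemLp f 2 volume ∧ MemLp X 2 P ∧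
    ∃ c : ℕ → (UnitSquare →₀ ℝ),
      Tendsto (fun n => eLpNorm (fun x => stepFunction (c n) x - f x) 2 volume) atTop (𝓝 0) ∧
      Tendsto (fun n => eLpNorm (fun ω => stepIntegral W (c n) ω - X ω) 2 P) atTop (𝓝 0)

/-- `X` is a measurable random function `t ↦ ∫ ψ(t,x) W(dx)` on `[0,1]²`: it is jointly measurable
in `(t, ω)`, and for almost every `t` (the sections of a square integrable `ψ` are square
integrable for almost every `t` only) `X t` is the Wiener integral of `ψ(t,·)`. -/
structure IsWienerRandomFunction {Ω : Type*} [MeasurableSpace Ω] (W : UnitSquare → Ω → ℝ)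
    (P : Measure Ω) (ψ : UnitSquare × UnitSquare → ℝ) (X : UnitSquare → Ω → ℝ) : Prop where
  measurable : Measurable (fun p : UnitSquare × Ω => X p.1 p.2)
  isWienerIntegral : ∀ᵐ t, IsWienerIntegral W P (fun x => ψ (t, x)) (X t)

end

/-!
The kernel `φ` is approximated in `L²([0,1]⁴)` by simple kernels, finite linear combinations of
`1_{[0,s]}(t) 1_{[0,u]}(x)` (`exists_seq_simpleKernel_tendsto`). By the Itô isometry the
corresponding random functions converge in `L²([0,1]² × Ω)`. The limit is a random function as
required (`IsBrownianSheet.exists_isWienerRandomFunction`), and every such random function is this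
limit (`IsWienerRandomFunction.eLpNorm_sub_le`), so it lies in `L²([0,1]² × Ω)`, which gives
the almost sure integrability of its square.

For a simple kernel `φ`, let `W'` be an independent copy of `W` and consider the double integral
`Z = ∬ φ(t, x) W'(dt) W(dx)`, a finite sum. Given `W`, it is a centered Gaussian variable with
variance `∫ X(t)² dt`; given `W'`, it is a centered Gaussian variable whose variance has the law of
`∫ Y(t)² dt`. Computing `E[exp (i r Z)]` by Fubini in both orders thus yields
`E[exp (-r²/2 ∫ X²)] = E[exp (-r²/2 ∫ Y²)]` (`IsBrownianSheet.integral_exp_simpleKernel_swap`).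
This equality of Laplace transforms passes to the limit (`tendsto_integral_exp_neg_integral_sq`),
and Laplace transforms determine laws on the half-line (`ext_of_integral_exp_neg_nat_mul`).
-/

noncomputable section
open scoped ENNReal NNReal BoundedContinuousFunction

/-! ### Laplace transforms -/

/-- The bounded continuous function `x ↦ exp (-x)` on the half-line. -/
def expNegBCF : ℝ≥0 →ᵇ ℝ :=
  BoundedContinuousFunction.ofNormedAddCommGroup (fun x : ℝ≥0 => Real.exp (-(x : ℝ)))
    (by fun_prop) 1 (fun x => by simp)

lemma expNegBCF_apply (x : ℝ≥0) : expNegBCF x = Real.exp (-(x : ℝ)) := rfl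

/-- The polynomials in `exp (-x)` form an algebra of bounded continuous functions that separates
points, so a finite measure on the half-line is determined by its Laplace transform at the natural
numbers. -/
theorem ext_of_integral_exp_neg_nat_mul {μ ν : Measure ℝ≥0} [IsFiniteMeasure μ]
    [IsFiniteMeasure ν]
    (h : ∀ n : ℕ, ∫ x : ℝ≥0, Real.exp (-(n * (x : ℝ))) ∂μ
      = ∫ x : ℝ≥0, Real.exp (-(n * (x : ℝ))) ∂ν) :
    μ = ν := by
  refine ext_of_forall_mem_subalgebra_integral_eq_of_polish
    (A := StarAlgebra.adjoin ℝ {expNegBCF}) ?_ ?_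
  · intro x y hxy
    refine ⟨expNegBCF, ⟨(expNegBCF : C(ℝ≥0, ℝ)), ?_, rfl⟩, ?_⟩
    · exact ⟨expNegBCF, StarAlgebra.subset_adjoin ℝ _ rfl, rfl⟩
    · simpa [expNegBCF_apply] using hxy
  · intro g hg
    have hg' : g ∈ Algebra.adjoin ℝ {expNegBCF} := by
      have : g ∈ (StarAlgebra.adjoin ℝ {expNegBCF}).toSubalgebra := hg
      rw [StarAlgebra.adjoin_toSubalgebra] at this
      have hs : star ({expNegBCF} : Set (ℝ≥0 →ᵇ ℝ)) = {expNegBCF} := by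
        rw [Set.star_singleton]
        congr 1
      simpa [hs] using this
    rw [Algebra.adjoin_singleton_eq_range_aeval] at hg'
    obtain ⟨p, rfl⟩ := hg'
    clear hg
    change ∫ x, Polynomial.aeval expNegBCF p x ∂μ = ∫ x, Polynomial.aeval expNegBCF p x ∂ν
    induction p using Polynomial.induction_on' with
    | add p q hp hq =>
      simp only [map_add, BoundedContinuousFunction.coe_add, Pi.add_apply]
      rw [integral_add (BoundedContinuousFunction.integrable _ _)
          (BoundedContinuousFunction.integrable _ _),
        integral_add (BoundedContinuousFunction.integrable _ _)
          (BoundedContinuousFunction.integrable _ _), hp, hq]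
    | monomial n a =>
      have hpow (x : ℝ≥0) : Polynomial.aeval expNegBCF (Polynomial.monomial n a) x
          = a * Real.exp (-(n * (x : ℝ))) := by
        rw [Polynomial.aeval_monomial, ← mul_neg, Real.exp_nat_mul]
        simp [expNegBCF_apply, Algebra.algebraMap_eq_smul_one]
      simp only [hpow, integral_const_mul, h n]

lemma identDistrib_of_integral_exp_neg_nat_mul {Ω : Type*} [MeasurableSpace Ω] {P : Measure Ω}
    [IsFiniteMeasure P] {U V : Ω → ℝ} (hU : AEMeasurable U P) (hV : AEMeasurable V P)
    (hU0 : ∀ ω, 0 ≤ U ω) (hV0 : ∀ ω, 0 ≤ V ω)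
    (h : ∀ n : ℕ, ∫ ω, Real.exp (-(n * U ω)) ∂P = ∫ ω, Real.exp (-(n * V ω)) ∂P) :
    IdentDistrib U V P P := by
  have key : P.map (fun ω => (U ω).toNNReal) = P.map (fun ω => (V ω).toNNReal) := by
    refine ext_of_integral_exp_neg_nat_mul fun n => ?_
    have hm : Measurable fun x : ℝ≥0 => Real.exp (-(n * (x : ℝ))) := by fun_prop
    rw [integral_map hU.real_toNNReal hm.aestronglyMeasurable,
      integral_map hV.real_toNNReal hm.aestronglyMeasurable]
    simpa [Real.coe_toNNReal, hU0, hV0] using h n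
  refine ⟨hU, hV, ?_⟩
  have e (Z : Ω → ℝ) (hZ : AEMeasurable Z P) (hZ0 : ∀ ω, 0 ≤ Z ω) :
      P.map Z = (P.map (fun ω => (Z ω).toNNReal)).map (fun x : ℝ≥0 => (x : ℝ)) := by
    rw [AEMeasurable.map_map_of_aemeasurable (by fun_prop) hZ.real_toNNReal]
    congr 1
    ext ω
    simp [hZ0]
  rw [e U hU hU0, e V hV hV0, key]

/-! ### Convergence in `L²` -/

section L2
variable {α β : Type*} [MeasurableSpace α] [MeasurableSpace β] {μ : Measure α} {ν : Measure β}

lemma eLpNorm_two_sq (f : α → ℝ) : eLpNorm f 2 μ ^ 2 = ∫⁻ x, ‖f x‖ₑ ^ 2 ∂μ := by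
  simpa using eLpNorm_nnreal_pow_eq_lintegral (μ := μ) (f := f) (p := 2) two_ne_zero

lemma tendsto_sq_zero_iff_of_ennreal {u : ℕ → ℝ≥0∞} :
    Tendsto (fun n => u n ^ 2) atTop (𝓝 0) ↔ Tendsto u atTop (𝓝 0) := by
  refine ⟨fun h => ?_, fun h => by simpa using ENNReal.Tendsto.pow (n := 2) h⟩
  have := (ENNReal.continuous_rpow_const (y := 1 / 2)).tendsto 0 |>.comp h
  have e (x : ℝ≥0∞) : (x ^ 2) ^ (1 / 2 : ℝ) = x := by
    rw [← ENNReal.rpow_ofNat, ← ENNReal.rpow_mul]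
    norm_num
  simpa only [Function.comp_def, e, ENNReal.zero_rpow_of_pos (one_half_pos (α := ℝ))] using this

lemma eLpNorm_two_prod_sq [SFinite ν] {f : α × β → ℝ}
    (hf : AEStronglyMeasurable f (μ.prod ν)) :
    eLpNorm f 2 (μ.prod ν) ^ 2 = ∫⁻ x, eLpNorm (fun y => f (x, y)) 2 ν ^ 2 ∂μ := by
  simp only [eLpNorm_two_sq]
  exact lintegral_prod _ (hf.enorm.pow_const 2)

lemma eLpNorm_two_prod_le [SFinite ν] {γ : Type*} [MeasurableSpace γ] {ρ : Measure γ} [SFinite ρ]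
    {f : α × β → ℝ} {g : α × γ → ℝ} (hf : AEStronglyMeasurable f (μ.prod ν))
    (hg : AEStronglyMeasurable g (μ.prod ρ))
    (h : ∀ᵐ x ∂μ, eLpNorm (fun y => f (x, y)) 2 ν ≤ eLpNorm (fun y => g (x, y)) 2 ρ) :
    eLpNorm f 2 (μ.prod ν) ≤ eLpNorm g 2 (μ.prod ρ) := by
  rw [← ENNReal.pow_le_pow_left_iff two_ne_zero, eLpNorm_two_prod_sq hf, eLpNorm_two_prod_sq hg]
  exact lintegral_mono_ae (h.mono fun x hx => by gcongr)

/-- Convergence to `0` in `L¹` implies almost everywhere convergence along a subsequence whose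
integrals are summable. -/
lemma exists_subseq_ae_tendsto_zero {g : ℕ → α → ℝ≥0∞} (hg : ∀ n, AEMeasurable (g n) μ)
    (h : Tendsto (fun n => ∫⁻ x, g n x ∂μ) atTop (𝓝 0)) :
    ∃ ns : ℕ → ℕ, StrictMono ns ∧ ∀ᵐ x ∂μ, Tendsto (fun k => g (ns k) x) atTop (𝓝 0) := by
  obtain ⟨ns, hns, hlt⟩ := extraction_forall_of_eventually'
    (P := fun n k => ∫⁻ x, g k x ∂μ < (2⁻¹ : ℝ≥0∞) ^ n)
    (fun n => h.eventually_lt_const (ENNReal.pow_pos (by simp) n) |>.exists_forall_of_atTop)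
  refine ⟨ns, hns, ?_⟩
  have hfin : ∫⁻ x, ∑' k, g (ns k) x ∂μ ≠ ∞ := by
    rw [lintegral_tsum fun k => hg _]
    refine ne_top_of_le_ne_top ?_ (ENNReal.tsum_le_tsum fun k => (hlt k).le)
    rw [ENNReal.tsum_geometric]
    simp
  filter_upwards [ae_lt_top' (AEMeasurable.tsum fun k => hg _) hfin] with x hx
  exact ENNReal.tendsto_atTop_zero_of_tsum_ne_top hx.ne

lemma exists_subseq_ae_tendsto_eLpNorm_section [SFinite ν] {f : ℕ → α × β → ℝ}
    (hf : ∀ n, AEStronglyMeasurable (f n) (μ.prod ν))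
    (h : Tendsto (fun n => eLpNorm (f n) 2 (μ.prod ν)) atTop (𝓝 0)) :
    ∃ ns : ℕ → ℕ, StrictMono ns ∧
      ∀ᵐ x ∂μ, Tendsto (fun k => eLpNorm (fun y => f (ns k) (x, y)) 2 ν) atTop (𝓝 0) := by
  obtain ⟨ns, hns, hx⟩ := exists_subseq_ae_tendsto_zero (μ := μ)
    (g := fun n x => eLpNorm (fun y => f n (x, y)) 2 ν ^ 2)
    (fun n => by
      simp only [eLpNorm_two_sq]
      exact ((hf n).enorm.pow_const 2).lintegral_prod_right')
    (by simpa only [← eLpNorm_two_prod_sq (hf _)] using tendsto_sq_zero_iff_of_ennreal.2 h)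
  exact ⟨ns, hns, hx.mono fun x hx => tendsto_sq_zero_iff_of_ennreal.1 hx⟩

lemma norm_toLp_two_sq {f : α → ℝ} (hf : MemLp f 2 μ) : ‖hf.toLp f‖ ^ 2 = ∫ x, f x ^ 2 ∂μ := by
  rw [← real_inner_self_eq_norm_sq, L2.inner_def]
  refine integral_congr_ae ?_
  filter_upwards [hf.coeFn_toLp] with x hx
  simp [hx, sq]

lemma tendsto_integral_sq_of_tendsto_eLpNorm {f : ℕ → α → ℝ} {g : α → ℝ}
    (hf : ∀ n, MemLp (f n) 2 μ) (hg : MemLp g 2 μ)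
    (h : Tendsto (fun n => eLpNorm (fun x => f n x - g x) 2 μ) atTop (𝓝 0)) :
    Tendsto (fun n => ∫ x, f n x ^ 2 ∂μ) atTop (𝓝 (∫ x, g x ^ 2 ∂μ)) := by
  have := ((Lp.tendsto_Lp_iff_tendsto_eLpNorm'' f hf g hg).2 h).norm.pow 2
  simpa only [norm_toLp_two_sq] using this

lemma memLp_two_section [SFinite μ] [SFinite ν] {f : α × β → ℝ} (hf : MemLp f 2 (μ.prod ν)) :
    ∀ᵐ x ∂μ, MemLp (fun y => f (x, y)) 2 ν := by
  filter_upwards [hf.integrable_sq.prod_right_ae, hf.aestronglyMeasurable.prodMk_left] with x h1 h2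
  exact (memLp_two_iff_integrable_sq h2).2 h1

/-- If `f n → g` in `L²(μ ⊗ ν)`, then the Laplace transforms of the random variables
`y ↦ ∫ f n (x, y) ^ 2 dx` converge. -/
lemma tendsto_integral_exp_neg_integral_sq [SFinite μ] [IsFiniteMeasure ν] {f : ℕ → α × β → ℝ}
    {g : α × β → ℝ} (hf : ∀ n, MemLp (f n) 2 (μ.prod ν)) (hg : MemLp g 2 (μ.prod ν))
    (h : Tendsto (fun n => eLpNorm (fun z => f n z - g z) 2 (μ.prod ν)) atTop (𝓝 0))
    {a : ℝ} (ha : 0 ≤ a) :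
    Tendsto (fun n => ∫ y, Real.exp (-(a * ∫ x, f n (x, y) ^ 2 ∂μ)) ∂ν) atTop
      (𝓝 (∫ y, Real.exp (-(a * ∫ x, g (x, y) ^ 2 ∂μ)) ∂ν)) := by
  -- Every subsequence has a further one along which `∫ f n (x, y) ^ 2 dx` converges for almost
  -- every `y`.
  refine tendsto_of_subseq_tendsto fun ns hns => ?_
  have hswap {k : α × β → ℝ} (hk : MemLp k 2 (μ.prod ν)) :
      MemLp (fun z : β × α => k z.swap) 2 (ν.prod μ) :=
    hk.comp_measurePreserving Measure.measurePreserving_swap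
  have hmeas {k : α × β → ℝ} (hk : MemLp k 2 (μ.prod ν)) :
      AEStronglyMeasurable (fun y => Real.exp (-(a * ∫ x, k (x, y) ^ 2 ∂μ))) ν := by
    have : AEStronglyMeasurable (fun y => ∫ x, k (x, y) ^ 2 ∂μ) ν :=
      ((hswap hk).aestronglyMeasurable.pow 2).integral_prod_right'
    exact Real.continuous_exp.comp_aestronglyMeasurable (this.const_mul a).neg
  have hsec {k : α × β → ℝ} (hk : MemLp k 2 (μ.prod ν)) :
      ∀ᵐ y ∂ν, MemLp (fun x => k (x, y)) 2 μ := memLp_two_section (hswap hk)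
  obtain ⟨ms, -, hms⟩ := exists_subseq_ae_tendsto_eLpNorm_section (μ := ν) (ν := μ)
    (f := fun n z => f (ns n) z.swap - g z.swap)
    (fun n => ((hswap (hf _)).sub (hswap hg)).aestronglyMeasurable)
    (by
      have e n : eLpNorm (fun z => f (ns n) z.swap - g z.swap) 2 (ν.prod μ)
          = eLpNorm (fun z => f (ns n) z - g z) 2 (μ.prod ν) :=
        eLpNorm_comp_measurePreserving (p := 2) (g := fun z => f (ns n) z - g z)
          ((hf _).sub hg).aestronglyMeasurable (Measure.measurePreserving_swap (μ := ν) (ν := μ))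
      simp only [e]
      exact h.comp hns)
  refine ⟨ms, tendsto_integral_of_dominated_convergence (fun _ => 1) (fun k => hmeas (hf _))
    (integrable_const _) (fun k => ae_of_all _ fun y => ?_) ?_⟩
  · rw [Real.norm_eq_abs, Real.abs_exp, Real.exp_le_one_iff, neg_nonpos]
    exact mul_nonneg ha (integral_nonneg fun x => sq_nonneg _)
  · filter_upwards [hms, hsec hg, ae_all_iff.2 fun n => hsec (hf n)] with y h1 h2 h3
    have := tendsto_integral_sq_of_tendsto_eLpNorm (fun k => h3 (ns (ms k))) h2 h1
    exact (Real.continuous_exp.tendsto _).comp (this.const_mul a).neg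

/-! ### Linear combinations and Gram matrices -/

lemma memLp_finsuppSum {ι : Type*} {U : ι → α → ℝ} (hU : ∀ i, MemLp (U i) 2 μ) (c : ι →₀ ℝ) :
    MemLp (fun x => c.sum fun i a => a * U i x) 2 μ := by
  unfold Finsupp.sum
  exact memLp_finsetSum _ fun i _ => (hU i).const_mul _

lemma integral_finsuppSum_sq {ι : Type*} {U : ι → α → ℝ} (hU : ∀ i, MemLp (U i) 2 μ)
    (c : ι →₀ ℝ) :
    ∫ x, (c.sum fun i a => a * U i x) ^ 2 ∂μ
      = ∑ i ∈ c.support, ∑ j ∈ c.support, c i * c j * ∫ x, U i x * U j x ∂μ := by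
  have hint i j : Integrable (fun x => U i x * U j x) μ := (hU i).integrable_mul (hU j)
  have e x : (c.sum fun i a => a * U i x) ^ 2
      = ∑ i ∈ c.support, ∑ j ∈ c.support, c i * c j * (U i x * U j x) := by
    rw [sq, Finsupp.sum, Finset.sum_mul_sum]
    exact Finset.sum_congr rfl fun i _ => Finset.sum_congr rfl fun j _ => by ring
  simp only [e]
  rw [integral_finsetSum _ fun i _ => integrable_finsetSum _ fun j _ => (hint i j).const_mul _]
  refine Finset.sum_congr rfl fun i _ => ?_
  rw [integral_finsetSum _ fun j _ => (hint i j).const_mul _]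
  exact Finset.sum_congr rfl fun j _ => integral_const_mul _ _

lemma eLpNorm_finsuppSum_eq_of_gram {ι : Type*} {U : ι → α → ℝ} {V : ι → β → ℝ}
    (hU : ∀ i, MemLp (U i) 2 μ) (hV : ∀ i, MemLp (V i) 2 ν)
    (h : ∀ i j, ∫ x, U i x * U j x ∂μ = ∫ y, V i y * V j y ∂ν) (c : ι →₀ ℝ) :
    eLpNorm (fun x => c.sum fun i a => a * U i x) 2 μ
      = eLpNorm (fun y => c.sum fun i a => a * V i y) 2 ν := by
  have h1 := memLp_finsuppSum hU c
  have h2 := memLp_finsuppSum hV c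
  rw [← ENNReal.toReal_eq_toReal_iff' h1.eLpNorm_ne_top h2.eLpNorm_ne_top, ← Lp.norm_toLp _ h1,
    ← Lp.norm_toLp _ h2, ← sq_eq_sq₀ (norm_nonneg _) (norm_nonneg _), norm_toLp_two_sq,
    norm_toLp_two_sq, integral_finsuppSum_sq hU, integral_finsuppSum_sq hV]
  simp only [h]

/-! ### Density of indicator functions of a π-system -/

/-- An `L²` function orthogonal to the indicators of a generating π-system integrates to zero over
every measurable set, hence vanishes; so these indicators span a dense subspace. -/
theorem exists_seq_tendsto_eLpNorm_of_isPiSystem [IsFiniteMeasure μ] {ι : Type*} {S : ι → Set α}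
    (hS : ∀ i, MeasurableSet (S i)) (hpi : IsPiSystem (Set.range S))
    (hgen : ‹MeasurableSpace α› = MeasurableSpace.generateFrom (Set.range S))
    (huniv : Set.univ ∈ Set.range S) {f : α → ℝ} (hf : MemLp f 2 μ) :
    ∃ c : ℕ → (ι →₀ ℝ), Tendsto (fun n => eLpNorm
      (fun x => ((c n).sum fun i a => a * (S i).indicator (fun _ => (1 : ℝ)) x) - f x) 2 μ)
      atTop (𝓝 0) := by
  let v (i : ι) : Lp ℝ 2 μ := indicatorConstLp 2 (hS i) (measure_ne_top μ _) 1
  have htop : (Submodule.span ℝ (Set.range v)).topologicalClosure = ⊤ := by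
    rw [Submodule.topologicalClosure_eq_top_iff, Submodule.eq_bot_iff]
    intro g hg
    have hgi : Integrable g μ := (Lp.memLp g).integrable one_le_two
    have h0 i : ∫ x in S i, g x ∂μ = 0 := by
      rw [← L2.inner_indicatorConstLp_one (𝕜 := ℝ) (hS i) (measure_ne_top μ _) g]
      exact (Submodule.mem_orthogonal _ _).1 hg _ (Submodule.subset_span ⟨i, rfl⟩)
    have hall : ∫ x, g x ∂μ = 0 := by
      obtain ⟨i, hi⟩ := huniv
      simpa [hi] using h0 i
    have hset s (hs : MeasurableSet s) : ∫ x in s, g x ∂μ = 0 := by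
      induction s, hs using MeasurableSpace.induction_on_inter hgen hpi with
      | empty => simp
      | basic s hs => obtain ⟨i, rfl⟩ := hs; exact h0 i
      | compl s hs ih =>
        have := integral_add_compl hs hgi
        rw [ih, hall] at this
        simpa using this
      | iUnion s hd hs ih =>
        rw [integral_iUnion hs hd hgi.integrableOn]
        simp [ih]
    rw [Lp.eq_zero_iff_ae_eq_zero]
    exact ae_eq_zero_of_forall_setIntegral_eq_of_sigmaFinite (fun s _ _ => hgi.integrableOn)
      fun s hs _ => hset s hs
  have hmem : hf.toLp f ∈ closure (Submodule.span ℝ (Set.range v) : Set (Lp ℝ 2 μ)) := by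
    rw [← Submodule.topologicalClosure_coe, htop]
    trivial
  obtain ⟨u, hu, hlim⟩ := mem_closure_iff_seq_limit.1 hmem
  choose c hc using fun n => Finsupp.mem_span_range_iff_exists_finsupp.1 (hu n)
  refine ⟨c, ?_⟩
  have hind i : MemLp ((S i).indicator (fun _ => (1 : ℝ))) 2 μ :=
    memLp_indicator_const 2 (hS i) 1 (Or.inr (measure_ne_top μ _))
  refine (Lp.tendsto_Lp_iff_tendsto_eLpNorm'' _ (fun n => memLp_finsuppSum hind (c n)) f hf).1 ?_
  refine hlim.congr fun n => ?_
  rw [← hc n]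
  refine Lp.ext ?_
  refine EventuallyEq.trans ?_ (MemLp.coeFn_toLp _).symm
  unfold Finsupp.sum
  refine (Lp.coeFn_finsetSum _ _).trans ?_
  have hall : ∀ᵐ x ∂μ, ∀ i ∈ (c n).support,
      ((c n i • v i : Lp ℝ 2 μ) : α → ℝ) x = c n i * (S i).indicator (fun _ => (1 : ℝ)) x := by
    refine (Finset.eventually_all _).2 fun i _ => ?_
    filter_upwards [Lp.coeFn_smul (c n i) (v i),
      indicatorConstLp_coeFn (p := 2) (hs := hS i) (hμs := measure_ne_top μ _) (c := (1 : ℝ))]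
      with x h1 h2
    rw [h1, Pi.smul_apply, smul_eq_mul, h2]
  filter_upwards [hall] with x hx
  rw [Finset.sum_apply]
  exact Finset.sum_congr rfl hx

end L2
/-! ### Simple kernels -/

/-- The values at `x` of the indicator functions of all rectangles `[0, s₁] × [0, s₂]`, as a
function of the corner `s`. -/
def rectIndicator (x s : UnitSquare) : ℝ := (Set.Iic s).indicator (fun _ => (1 : ℝ)) x

/-- The bilinear form `∑ₚ c(p) u(p₁) v(p₂)`. For `u = rectIndicator t`, `v = rectIndicator x` this
is a simple kernel evaluated at `(t, x)`; replacing `v` by the values of a Brownian sheet integrates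
the kernel in its second variable. -/
def simpleKernel (c : UnitSquare × UnitSquare →₀ ℝ) (u v : UnitSquare → ℝ) : ℝ :=
  c.sum fun p a => a * (u p.1 * v p.2)

/-- The coefficients of the linear form `simpleKernel c u`. -/
def sectionCoeff (c : UnitSquare × UnitSquare →₀ ℝ) (u : UnitSquare → ℝ) : UnitSquare →₀ ℝ :=
  c.sum fun p a => Finsupp.single p.2 (a * u p.1)

lemma sectionCoeff_sum (c : UnitSquare × UnitSquare →₀ ℝ) (u v : UnitSquare → ℝ) :
    (sectionCoeff c u).sum (fun s a => a * v s) = simpleKernel c u v := by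
  unfold sectionCoeff simpleKernel
  rw [Finsupp.sum_sum_index (by simp) (by intros; ring)]
  refine Finsupp.sum_congr fun p _ => ?_
  rw [Finsupp.sum_single_index (by simp), mul_assoc]

lemma stepFunction_sectionCoeff (c : UnitSquare × UnitSquare →₀ ℝ) (u : UnitSquare → ℝ)
    (x : UnitSquare) : stepFunction (sectionCoeff c u) x = simpleKernel c u (rectIndicator x) :=
  sectionCoeff_sum c u (rectIndicator x)

lemma stepIntegral_sectionCoeff {Ω : Type*} (W : UnitSquare → Ω → ℝ)
    (c : UnitSquare × UnitSquare →₀ ℝ) (u : UnitSquare → ℝ) (ω : Ω) :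
    stepIntegral W (sectionCoeff c u) ω = simpleKernel c u fun s => W s ω :=
  sectionCoeff_sum c u fun s => W s ω

lemma simpleKernel_mapDomain_swap (c : UnitSquare × UnitSquare →₀ ℝ) (u v : UnitSquare → ℝ) :
    simpleKernel (c.mapDomain Prod.swap) u v = simpleKernel c v u := by
  unfold simpleKernel
  rw [Finsupp.sum_mapDomain_index (by simp) (by intros; ring)]
  exact Finsupp.sum_congr fun p _ => by simp [mul_comm]

lemma memLp_rectIndicator (s : UnitSquare) : MemLp (fun x => rectIndicator x s) 2 volume :=
  memLp_indicator_const 2 measurableSet_Iic 1 (Or.inr (measure_ne_top _ _))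

lemma measurable_simpleKernel {α : Type*} [MeasurableSpace α] (c : UnitSquare × UnitSquare →₀ ℝ)
    {u v : α → UnitSquare → ℝ} (hu : ∀ s, Measurable fun z => u z s)
    (hv : ∀ s, Measurable fun z => v z s) : Measurable fun z => simpleKernel c (u z) (v z) := by
  unfold simpleKernel Finsupp.sum
  exact Finset.measurable_sum _ fun p _ => ((hu p.1).mul (hv p.2)).const_mul _

lemma memLp_two_mul_prod {α β : Type*} [MeasurableSpace α] [MeasurableSpace β] {μ : Measure α}
    {ν : Measure β} [SFinite μ] [SFinite ν] {f : α → ℝ} {g : β → ℝ} (hf : MemLp f 2 μ)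
    (hg : MemLp g 2 ν) : MemLp (fun z : α × β => f z.1 * g z.2) 2 (μ.prod ν) := by
  refine (memLp_two_iff_integrable_sq
    (hf.aestronglyMeasurable.comp_fst.mul hg.aestronglyMeasurable.comp_snd)).2 ?_
  simpa only [Pi.mul_apply, mul_pow] using hf.integrable_sq.mul_prod hg.integrable_sq

lemma memLp_simpleKernel {α β : Type*} [MeasurableSpace α] [MeasurableSpace β] {μ : Measure α}
    {ν : Measure β} [SFinite μ] [SFinite ν] (c : UnitSquare × UnitSquare →₀ ℝ)
    {u : α → UnitSquare → ℝ} {v : β → UnitSquare → ℝ} (hu : ∀ s, MemLp (fun z => u z s) 2 μ)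
    (hv : ∀ s, MemLp (fun z => v z s) 2 ν) :
    MemLp (fun z : α × β => simpleKernel c (u z.1) (v z.2)) 2 (μ.prod ν) :=
  memLp_finsuppSum (U := fun (p : UnitSquare × UnitSquare) (z : α × β) => u z.1 p.1 * v z.2 p.2)
    (fun p => memLp_two_mul_prod (hu p.1) (hv p.2)) c

/-- Simple kernels are dense in `L²([0,1]⁴)`. -/
theorem exists_seq_simpleKernel_tendsto {ψ : UnitSquare × UnitSquare → ℝ} (hψ : MemLp ψ 2 volume) :
    ∃ c : ℕ → (UnitSquare × UnitSquare →₀ ℝ), Tendsto (fun n => eLpNorm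
      (fun z => simpleKernel (c n) (rectIndicator z.1) (rectIndicator z.2) - ψ z) 2 volume)
      atTop (𝓝 0) := by
  have hI : MeasurableSpace.generateFrom (Set.range (Set.Iic : unitInterval → _))
      = (inferInstance : MeasurableSpace unitInterval) := by
    rw [← borel_eq_generateFrom_Iic, BorelSpace.measurable_eq (α := unitInterval)]
  have hprod {α β : Type} [Preorder α] [Preorder β] :
      Set.image2 (· ×ˢ ·) (Set.range (Set.Iic : α → Set α)) (Set.range (Set.Iic : β → Set β))
        = Set.range (Set.Iic : α × β → Set (α × β)) := by
    rw [Set.image2_range]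
    congr 1
  have hspan {α : Type} [Preorder α] [OrderTop α] :
      IsCountablySpanning (Set.range (Set.Iic : α → Set α)) :=
    ⟨fun _ => Set.univ, fun _ => ⟨⊤, Set.Iic_top⟩, by simp [Set.iUnion_const]⟩
  have hS : MeasurableSpace.generateFrom (Set.range (Set.Iic : UnitSquare → _))
      = (inferInstance : MeasurableSpace UnitSquare) := by
    rw [← hprod]
    exact generateFrom_eq_prod hI hI hspan hspan
  have hSS : MeasurableSpace.generateFrom (Set.range (Set.Iic : UnitSquare × UnitSquare → _))
      = (inferInstance : MeasurableSpace (UnitSquare × UnitSquare)) := by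
    rw [← hprod]
    exact generateFrom_eq_prod hS hS hspan hspan
  obtain ⟨c, hc⟩ := exists_seq_tendsto_eLpNorm_of_isPiSystem
    (S := (Set.Iic : UnitSquare × UnitSquare → _)) (fun _ => measurableSet_Iic)
    (by
      rw [← hprod, ← hprod]
      exact (isPiSystem_Iic.prod isPiSystem_Iic).prod (isPiSystem_Iic.prod isPiSystem_Iic))
    hSS.symm ⟨⊤, Set.Iic_top⟩ hψ
  refine ⟨c, hc.congr fun n => ?_⟩
  congr! 3 with z
  refine Finsupp.sum_congr fun p _ => ?_
  congr 1
  by_cases h1 : z.1 ≤ p.1 <;> by_cases h2 : z.2 ≤ p.2 <;>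
    simp [rectIndicator, Set.indicator, h1, h2, Prod.le_def (x := z)]

/-! ### The Wiener integral of step functions -/

lemma stepFunction_sub (c d : UnitSquare →₀ ℝ) (x : UnitSquare) :
    stepFunction (c - d) x = stepFunction c x - stepFunction d x :=
  Finsupp.sum_sub_index fun _ _ _ => sub_mul _ _ _

lemma stepIntegral_sub {Ω : Type*} (W : UnitSquare → Ω → ℝ) (c d : UnitSquare →₀ ℝ) (ω : Ω) :
    stepIntegral W (c - d) ω = stepIntegral W c ω - stepIntegral W d ω :=
  Finsupp.sum_sub_index fun _ _ _ => sub_mul _ _ _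

lemma memLp_stepFunction (c : UnitSquare →₀ ℝ) : MemLp (stepFunction c) 2 volume :=
  memLp_finsuppSum memLp_rectIndicator c

lemma integral_rectIndicator_mul (s t : UnitSquare) :
    ∫ x, rectIndicator x s * rectIndicator x t
      = min (s.1 : ℝ) (t.1 : ℝ) * min (s.2 : ℝ) (t.2 : ℝ) := by
  have e (x : UnitSquare) : rectIndicator x s * rectIndicator x t
      = (Set.Iic (s.1 ⊓ t.1) ×ˢ Set.Iic (s.2 ⊓ t.2)).indicator (fun _ => (1 : ℝ)) x := by
    simp only [rectIndicator, mul_one, ← Set.inter_indicator_mul,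
      Set.Iic_prod_Iic, Set.Iic_inter_Iic]
    rfl
  simp only [e]
  rw [integral_indicator_const _ (measurableSet_Iic.prod measurableSet_Iic), Measure.real,
    Measure.volume_eq_prod, Measure.prod_prod, unitInterval.volume_Iic, unitInterval.volume_Iic,
    ENNReal.toReal_mul, ENNReal.toReal_ofReal (unitInterval.nonneg _),
    ENNReal.toReal_ofReal (unitInterval.nonneg _)]
  simp

section Sheet
variable {Ω : Type*} [MeasurableSpace Ω] {P : Measure Ω} {W W' : UnitSquare → Ω → ℝ}

namespace IsBrownianSheet

lemma congr (hW : IsBrownianSheet W P) (h : ∀ t, W t =ᵐ[P] W' t) : IsBrownianSheet W' P where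
  isGaussianProcess := hW.isGaussianProcess.congr h
  centered t := by rw [← hW.centered t, integral_congr_ae (h t)]
  covariance s t := by
    rw [← hW.covariance s t]
    refine integral_congr_ae ?_
    filter_upwards [h s, h t] with ω h1 h2
    rw [h1, h2]

lemma memLp (hW : IsBrownianSheet W P) (t : UnitSquare) : MemLp (W t) 2 P :=
  (hW.isGaussianProcess.hasGaussianLaw_eval t).memLp_two

lemma memLp_stepIntegral (hW : IsBrownianSheet W P) (c : UnitSquare →₀ ℝ) :
    MemLp (stepIntegral W c) 2 P :=
  memLp_finsuppSum hW.memLp c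

lemma integral_mul_eq (hW : IsBrownianSheet W P) (s t : UnitSquare) :
    ∫ x, rectIndicator x s * rectIndicator x t = ∫ ω, W s ω * W t ω ∂P := by
  rw [integral_rectIndicator_mul, hW.covariance]

/-- The Itô isometry for step functions. -/
lemma eLpNorm_stepIntegral (hW : IsBrownianSheet W P) (c : UnitSquare →₀ ℝ) :
    eLpNorm (stepIntegral W c) 2 P = eLpNorm (stepFunction c) 2 volume :=
  (eLpNorm_finsuppSum_eq_of_gram memLp_rectIndicator hW.memLp hW.integral_mul_eq c).symm

lemma integral_stepIntegral_sq (hW : IsBrownianSheet W P) (c : UnitSquare →₀ ℝ) :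
    ∫ ω, stepIntegral W c ω ^ 2 ∂P = ∫ x, stepFunction c x ^ 2 := by
  rw [← norm_toLp_two_sq (hW.memLp_stepIntegral c), ← norm_toLp_two_sq (memLp_stepFunction c),
    Lp.norm_toLp, Lp.norm_toLp, hW.eLpNorm_stepIntegral]

lemma hasGaussianLaw_stepIntegral (hW : IsBrownianSheet W P) (c : UnitSquare →₀ ℝ) :
    HasGaussianLaw (stepIntegral W c) P :=
  (hW.isGaussianProcess.smul c).hasGaussianLaw_fun_sum (I := c.support)

lemma integral_stepIntegral (hW : IsBrownianSheet W P) (c : UnitSquare →₀ ℝ) :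
    ∫ ω, stepIntegral W c ω ∂P = 0 := by
  have := hW.isGaussianProcess.isProbabilityMeasure
  unfold stepIntegral Finsupp.sum
  rw [integral_finsetSum _ fun t _ => ((hW.memLp t).integrable one_le_two).const_mul _]
  exact Finset.sum_eq_zero fun t _ => by rw [integral_const_mul, hW.centered, mul_zero]

/-- An elementary integral is a centered Gaussian variable, with variance given by the Itô
isometry. -/
lemma integral_cexp_stepIntegral (hW : IsBrownianSheet W P) (c : UnitSquare →₀ ℝ) (r : ℝ) :
    ∫ ω, Complex.exp (r * stepIntegral W c ω * Complex.I) ∂P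
      = (Real.exp (-(r ^ 2 / 2 * ∫ x, stepFunction c x ^ 2)) : ℝ) := by
  have hG := hW.hasGaussianLaw_stepIntegral c
  have := hW.isGaussianProcess.isProbabilityMeasure
  have hvar : Var[stepIntegral W c; P] = ∫ x, stepFunction c x ^ 2 := by
    rw [variance_of_integral_eq_zero hG.aemeasurable (hW.integral_stepIntegral c),
      hW.integral_stepIntegral_sq c]
  have h := charFun_gaussianReal (μ := ∫ ω, stepIntegral W c ω ∂P)
    (v := Var[stepIntegral W c; P].toNNReal) r
  rw [← hG.map_eq_gaussianReal, charFun_apply_real, integral_map hG.aemeasurable (by fun_prop),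
    hW.integral_stepIntegral c, hvar,
    Real.coe_toNNReal _ (integral_nonneg fun x => sq_nonneg _)] at h
  rw [h]
  push_cast
  congr 1
  ring

/-- Any approximation of the integrand by a step function approximates the Wiener integral at least
as well. -/
lemma eLpNorm_stepIntegral_sub_le (hW : IsBrownianSheet W P) {f : UnitSquare → ℝ} {X : Ω → ℝ}
    (hX : IsWienerIntegral W P f X) (c : UnitSquare →₀ ℝ) :
    eLpNorm (fun ω => stepIntegral W c ω - X ω) 2 P
      ≤ eLpNorm (fun x => stepFunction c x - f x) 2 volume := by
  obtain ⟨hf, hX2, d, hd, hdX⟩ := hX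
  have key n : eLpNorm (fun ω => stepIntegral W c ω - X ω) 2 P
      ≤ eLpNorm (fun x => stepFunction c x - f x) 2 volume
        + eLpNorm (fun x => stepFunction (d n) x - f x) 2 volume
        + eLpNorm (fun ω => stepIntegral W (d n) ω - X ω) 2 P := by
    have h1 : (fun ω => stepIntegral W c ω - X ω)
        = stepIntegral W (c - d n) + fun ω => stepIntegral W (d n) ω - X ω := by
      ext ω
      simp [stepIntegral_sub]
    have h2 : stepFunction (c - d n)
        = (fun x => stepFunction c x - f x) - fun x => stepFunction (d n) x - f x := by
      ext x
      simp [stepFunction_sub]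
    rw [h1]
    refine (eLpNorm_add_le (hW.memLp_stepIntegral _).aestronglyMeasurable
      ((hW.memLp_stepIntegral _).sub hX2).aestronglyMeasurable one_le_two).trans ?_
    refine add_le_add_left ?_ _
    rw [hW.eLpNorm_stepIntegral, h2]
    exact eLpNorm_sub_le ((memLp_stepFunction _).sub hf).aestronglyMeasurable
      ((memLp_stepFunction _).sub hf).aestronglyMeasurable one_le_two
  have hlim := (tendsto_const_nhds (x := eLpNorm (fun x => stepFunction c x - f x) 2 volume)
    |>.add hd).add hdX
  rw [add_zero, add_zero] at hlim
  exact ge_of_tendsto' hlim key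

end IsBrownianSheet

/-! ### Measurable random functions of Wiener integrals -/

lemma IsWienerRandomFunction.congr_sheet {ψ : UnitSquare × UnitSquare → ℝ}
    {X : UnitSquare → Ω → ℝ} (hX : IsWienerRandomFunction W P ψ X) (h : ∀ t, W t =ᵐ[P] W' t) :
    IsWienerRandomFunction W' P ψ X where
  measurable := hX.measurable
  isWienerIntegral := by
    filter_upwards [hX.isWienerIntegral] with t ht
    obtain ⟨h1, h2, c, hc, hcX⟩ := ht
    refine ⟨h1, h2, c, hc, hcX.congr fun n => eLpNorm_congr_ae ?_⟩
    have hall : ∀ᵐ ω ∂P, ∀ t ∈ (c n).support, W t ω = W' t ω :=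
      (Finset.eventually_all _).2 fun t _ => h t
    filter_upwards [hall] with ω hω
    congr 1
    exact Finset.sum_congr rfl fun t ht => congrArg (c n t * ·) (hω t ht)

variable [IsProbabilityMeasure P]

lemma IsWienerRandomFunction.eLpNorm_sub_le {ψ : UnitSquare × UnitSquare → ℝ}
    {X : UnitSquare → Ω → ℝ} (hX : IsWienerRandomFunction W P ψ X) (hW : IsBrownianSheet W P)
    (hψ : MemLp ψ 2 volume) (c : UnitSquare × UnitSquare →₀ ℝ) :
    eLpNorm (fun z : UnitSquare × Ω =>
        simpleKernel c (rectIndicator z.1) (fun s => W s z.2) - X z.1 z.2) 2 (volume.prod P)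
      ≤ eLpNorm (fun z => simpleKernel c (rectIndicator z.1) (rectIndicator z.2) - ψ z)
        2 volume := by
  refine eLpNorm_two_prod_le
    ((memLp_simpleKernel c memLp_rectIndicator hW.memLp).aestronglyMeasurable.sub
      hX.measurable.aestronglyMeasurable)
    (((memLp_simpleKernel c memLp_rectIndicator memLp_rectIndicator).sub hψ).aestronglyMeasurable)
    ?_
  filter_upwards [hX.isWienerIntegral] with t ht
  simpa only [stepIntegral_sectionCoeff, stepFunction_sectionCoeff] using
    hW.eLpNorm_stepIntegral_sub_le ht (sectionCoeff c (rectIndicator t))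

lemma IsWienerRandomFunction.memLp {ψ : UnitSquare × UnitSquare → ℝ}
    {X : UnitSquare → Ω → ℝ} (hX : IsWienerRandomFunction W P ψ X) (hW : IsBrownianSheet W P)
    (hψ : MemLp ψ 2 volume) : MemLp (fun z : UnitSquare × Ω => X z.1 z.2) 2 (volume.prod P) := by
  -- Comparing with the zero kernel bounds the norm of `X` by that of `ψ`.
  have hle := hX.eLpNorm_sub_le hW hψ 0
  simp only [simpleKernel, Finsupp.sum_zero_index, zero_sub] at hle
  refine ⟨hX.measurable.aestronglyMeasurable, lt_of_le_of_lt ?_ hψ.eLpNorm_lt_top⟩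
  simpa only [← Pi.neg_def, eLpNorm_neg] using hle

/-- The random functions obtained from simple kernels converging to `ψ` form a Cauchy sequence in
`L²([0,1]² × Ω)` by the Itô isometry; their limit is the random function sought. -/
theorem IsBrownianSheet.exists_isWienerRandomFunction (hW : IsBrownianSheet W P)
    {ψ : UnitSquare × UnitSquare → ℝ} (hψ : MemLp ψ 2 volume) :
    ∃ X, IsWienerRandomFunction W P ψ X := by
  obtain ⟨c, hc⟩ := exists_seq_simpleKernel_tendsto hψ
  let K (n : ℕ) (z : UnitSquare × UnitSquare) : ℝ :=
    simpleKernel (c n) (rectIndicator z.1) (rectIndicator z.2)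
  let F (n : ℕ) (z : UnitSquare × Ω) : ℝ :=
    simpleKernel (c n) (rectIndicator z.1) fun s => W s z.2
  have hK n : MemLp (K n) 2 volume :=
    memLp_simpleKernel (c n) memLp_rectIndicator memLp_rectIndicator
  have hF n : MemLp (F n) 2 (volume.prod P) :=
    memLp_simpleKernel (c n) memLp_rectIndicator hW.memLp
  have hiso m n : eLpNorm (F m - F n) 2 (volume.prod P) = eLpNorm (K m - K n) 2 volume := by
    have hsub (u v : UnitSquare → ℝ) : simpleKernel (c m) u v - simpleKernel (c n) u v
        = simpleKernel (c m - c n) u v := (Finsupp.sum_sub_index fun _ _ _ => sub_mul _ _ _).symm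
    have h1 : F m - F n
        = fun z => (c m - c n).sum fun p a => a * (rectIndicator z.1 p.1 * W p.2 z.2) := by
      ext z
      exact hsub _ _
    have h2 : K m - K n
        = fun z => (c m - c n).sum fun p a =>
          a * (rectIndicator z.1 p.1 * rectIndicator z.2 p.2) := by
      ext z
      exact hsub _ _
    rw [h1, h2]
    refine eLpNorm_finsuppSum_eq_of_gram
      (U := fun (p : UnitSquare × UnitSquare) (z : UnitSquare × Ω) =>
        rectIndicator z.1 p.1 * W p.2 z.2)
      (V := fun (p : UnitSquare × UnitSquare) (z : UnitSquare × UnitSquare) =>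
        rectIndicator z.1 p.1 * rectIndicator z.2 p.2)
      (fun p => memLp_two_mul_prod (memLp_rectIndicator p.1) (hW.memLp p.2))
      (fun p => memLp_two_mul_prod (memLp_rectIndicator p.1) (memLp_rectIndicator p.2))
      (fun p q => ?_) _
    simp only [mul_mul_mul_comm (rectIndicator _ p.1) _ (rectIndicator _ q.1)]
    rw [integral_prod_mul (fun t => rectIndicator t p.1 * rectIndicator t q.1)
        (fun ω => W p.2 ω * W q.2 ω),
      ← hW.integral_mul_eq]
    exact (integral_prod_mul (fun t => rectIndicator t p.1 * rectIndicator t q.1)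
      (fun x => rectIndicator x p.2 * rectIndicator x q.2)).symm
  have hcauchy : CauchySeq fun n => (hF n).toLp (F n) := by
    have hconv : CauchySeq fun n => (hK n).toLp (K n) :=
      ((Lp.tendsto_Lp_iff_tendsto_eLpNorm'' K hK ψ hψ).2 hc).cauchySeq
    rw [EMetric.cauchySeq_iff] at hconv ⊢
    simpa only [Lp.edist_toLp_toLp, hiso] using hconv
  obtain ⟨G, hG⟩ := cauchySeq_tendsto_of_complete hcauchy
  have hG' : Tendsto (fun n => eLpNorm (F n - (G : UnitSquare × Ω → ℝ)) 2 (volume.prod P))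
      atTop (𝓝 0) := by
    refine (Lp.tendsto_Lp_iff_tendsto_eLpNorm'' F hF G (Lp.memLp G)).1 ?_
    rwa [Lp.toLp_coeFn]
  obtain ⟨ns, hns, hK0⟩ := exists_subseq_ae_tendsto_eLpNorm_section
    (f := fun n => K n - ψ) (fun n => ((hK n).sub hψ).aestronglyMeasurable) hc
  obtain ⟨ms, hms, hF0⟩ := exists_subseq_ae_tendsto_eLpNorm_section
    (f := fun n => F (ns n) - (G : UnitSquare × Ω → ℝ))
    (fun n => ((hF _).sub (Lp.memLp G)).aestronglyMeasurable)
    (hG'.comp hns.tendsto_atTop)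
  refine ⟨fun t ω => G (t, ω), (Lp.stronglyMeasurable G).measurable, ?_⟩
  filter_upwards [hK0, hF0, memLp_two_section hψ, memLp_two_section (Lp.memLp G)]
    with t h1 h2 h3 h4
  refine ⟨h3, h4, fun k => sectionCoeff (c (ns (ms k))) (rectIndicator t), ?_, ?_⟩
  · simp only [stepFunction_sectionCoeff]
    exact h1.comp hms.tendsto_atTop
  · simp only [stepIntegral_sectionCoeff]
    exact h2

/-! ### Equality in law -/

/-- For an independent copy `W'` of `W`, the double integral of a simple kernel against `W'` and `W`
is, conditionally on one of the two sheets, a centered Gaussian variable whose variance is the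
square integral of the partial Wiener integral. Computing its characteristic function in both
orders gives the same Laplace transform for both square integrals. -/
lemma IsBrownianSheet.integral_exp_simpleKernel_swap (hW : IsBrownianSheet W P)
    (hmeas : ∀ t, Measurable (W t)) (c : UnitSquare × UnitSquare →₀ ℝ) (r : ℝ) :
    ∫ ω, Real.exp (-(r ^ 2 / 2 *
        ∫ t, simpleKernel c (rectIndicator t) (fun s => W s ω) ^ 2)) ∂P
      = ∫ ω, Real.exp (-(r ^ 2 / 2 *
        ∫ t, simpleKernel c (fun s => W s ω) (rectIndicator t) ^ 2)) ∂P := by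
  have key (d : UnitSquare × UnitSquare →₀ ℝ) :
      ((∫ ω, Real.exp (-(r ^ 2 / 2 *
          ∫ t, simpleKernel d (fun s => W s ω) (rectIndicator t) ^ 2)) ∂P : ℝ) : ℂ)
        = ∫ ω, ∫ ω', Complex.exp
          (r * simpleKernel d (fun s => W s ω) (fun s => W s ω') * Complex.I) ∂P ∂P := by
    rw [← integral_complex_ofReal]
    congr 1 with ω
    have := hW.integral_cexp_stepIntegral (sectionCoeff d fun s => W s ω) r
    simp only [stepIntegral_sectionCoeff, stepFunction_sectionCoeff] at this
    exact this.symm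
  have hsw := key (c.mapDomain Prod.swap)
  simp only [simpleKernel_mapDomain_swap] at hsw
  rw [← Complex.ofReal_inj, hsw, key c, integral_integral_swap]
  have hm : Measurable fun z : Ω × Ω =>
      simpleKernel c (fun s => W s z.2) (fun s => W s z.1) :=
    measurable_simpleKernel c (fun s => (hmeas s).comp measurable_snd)
      fun s => (hmeas s).comp measurable_fst
  refine Integrable.of_bound (C := 1) (Measurable.aestronglyMeasurable ?_) (ae_of_all _ fun z => ?_)
  · exact Complex.measurable_exp.comp
      (((Complex.measurable_ofReal.comp hm).const_mul _).mul_const _)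
  · rw [Function.uncurry_def]
    simp only [← Complex.ofReal_mul, Complex.norm_exp_ofReal_mul_I, le_refl]

theorem IsBrownianSheet.identDistrib_integral_sq (hW : IsBrownianSheet W P)
    (hmeas : ∀ t, Measurable (W t)) {φ : UnitSquare × UnitSquare → ℝ} (hφ : MemLp φ 2 volume)
    {X Y : UnitSquare → Ω → ℝ} (hX : IsWienerRandomFunction W P φ X)
    (hY : IsWienerRandomFunction W P (fun p => φ (p.2, p.1)) Y) :
    IdentDistrib (fun ω => ∫ t, X t ω ^ 2) (fun ω => ∫ t, Y t ω ^ 2) P P := by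
  have hφ' : MemLp (fun p : UnitSquare × UnitSquare => φ (p.2, p.1)) 2 volume :=
    hφ.comp_measurePreserving Measure.measurePreserving_swap
  have hlaw {Z : UnitSquare → Ω → ℝ} (hZ : Measurable fun p : UnitSquare × Ω => Z p.1 p.2) :
      AEMeasurable (fun ω => ∫ t, Z t ω ^ 2) P :=
    ((hZ.comp measurable_swap).pow_const 2).stronglyMeasurable.integral_prod_right'
      |>.measurable.aemeasurable
  refine identDistrib_of_integral_exp_neg_nat_mul (hlaw hX.measurable) (hlaw hY.measurable)
    (fun ω => integral_nonneg fun t => sq_nonneg _) (fun ω => integral_nonneg fun t => sq_nonneg _)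
    fun n => ?_
  obtain ⟨c, hc⟩ := exists_seq_simpleKernel_tendsto hφ
  have hX' := tendsto_integral_exp_neg_integral_sq
    (fun k => memLp_simpleKernel (c k) memLp_rectIndicator hW.memLp) (hX.memLp hW hφ)
    (tendsto_of_tendsto_of_tendsto_of_le_of_le tendsto_const_nhds hc (fun _ => zero_le)
      fun k => hX.eLpNorm_sub_le hW hφ (c k)) n.cast_nonneg
  have hc' : Tendsto (fun k => eLpNorm (fun z : UnitSquare × UnitSquare =>
      simpleKernel ((c k).mapDomain Prod.swap) (rectIndicator z.1) (rectIndicator z.2)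
        - φ (z.2, z.1)) 2 volume) atTop (𝓝 0) := by
    refine hc.congr fun k => ?_
    simp only [simpleKernel_mapDomain_swap]
    exact (eLpNorm_comp_measurePreserving (p := 2)
      (g := fun z => simpleKernel (c k) (rectIndicator z.1) (rectIndicator z.2) - φ z)
      ((memLp_simpleKernel (c k) memLp_rectIndicator
        memLp_rectIndicator).sub hφ).aestronglyMeasurable
      (Measure.measurePreserving_swap (μ := volume) (ν := volume))).symm
  have hY' := tendsto_integral_exp_neg_integral_sq
    (fun k => memLp_simpleKernel ((c k).mapDomain Prod.swap) memLp_rectIndicator hW.memLp)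
    (hY.memLp hW hφ')
    (tendsto_of_tendsto_of_tendsto_of_le_of_le tendsto_const_nhds hc' (fun _ => zero_le)
      fun k => hY.eLpNorm_sub_le hW hφ' _) n.cast_nonneg
  refine tendsto_nhds_unique hX' (hY'.congr fun k => ?_)
  -- The value `r = √(2n)` makes the coefficient `r ^ 2 / 2` of the Laplace exponent equal to `n`.
  have := hW.integral_exp_simpleKernel_swap hmeas (c k) √(2 * n)
  rw [Real.sq_sqrt (by positivity), mul_div_cancel_left₀ _ two_ne_zero] at this
  simp only [simpleKernel_mapDomain_swap]
  exact this.symm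

lemma IsWienerRandomFunction.ae_integrable_sq {ψ : UnitSquare × UnitSquare → ℝ}
    {X : UnitSquare → Ω → ℝ} (hX : IsWienerRandomFunction W P ψ X) (hW : IsBrownianSheet W P)
    (hψ : MemLp ψ 2 volume) : ∀ᵐ ω ∂P, Integrable (fun t => X t ω ^ 2) volume :=
  (hX.memLp hW hψ).integrable_sq.prod_left_ae

end Sheet
end

theorem theorem1 {Ω : Type*} [MeasurableSpace Ω] (P : Measure Ω) [IsProbabilityMeasure P]
    (W : UnitSquare → Ω → ℝ) (hW : IsBrownianSheet W P)
    (φ : UnitSquare × UnitSquare → ℝ) (hφ : MemLp φ 2 volume) :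
    (∃ X, IsWienerRandomFunction W P φ X) ∧
    (∃ Y, IsWienerRandomFunction W P (fun p => φ (p.2, p.1)) Y) ∧
    ∀ X Y, IsWienerRandomFunction W P φ X →
      IsWienerRandomFunction W P (fun p => φ (p.2, p.1)) Y →
      (∀ᵐ ω ∂P, Integrable (fun t => X t ω ^ 2) volume) ∧
      (∀ᵐ ω ∂P, Integrable (fun t => Y t ω ^ 2) volume) ∧
      IdentDistrib (fun ω => ∫ t, X t ω ^ 2) (fun ω => ∫ t, Y t ω ^ 2) P P := by
  have hφ' : MemLp (fun p : UnitSquare × UnitSquare => φ (p.2, p.1)) 2 volume :=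
    hφ.comp_measurePreserving Measure.measurePreserving_swap
  refine ⟨hW.exists_isWienerRandomFunction hφ, hW.exists_isWienerRandomFunction hφ',
    fun X Y hX hY => ⟨hX.ae_integrable_sq hW hφ, hY.ae_integrable_sq hW hφ', ?_⟩⟩
  -- Fubini on `Ω × Ω` needs a sheet with measurable, not just almost everywhere measurable, values.
  have hae := hW.isGaussianProcess.aemeasurable
  have hmod t : W t =ᵐ[P] (hae t).mk (W t) := (hae t).ae_eq_mk
  exact (hW.congr hmod).identDistrib_integral_sq (fun t => (hae t).measurable_mk) hφ
    (hX.congr_sheet hmod) (hY.congr_sheet hmod)
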